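/- Let $\mathfrak D$ be a residually finite Dedekind domain (a Dedekind domain in which $\mathfrak D/\mathfrak n$ is finite for every nonzero ideal $\mathfrak n$). For a nonzero ideal $\mathfrak m$ let $N(\mathfrak m)=|\mathfrak D/\mathfrak m|$, let $\varphi_{\mathfrak D}(\mathfrak m)=|(\mathfrak D/\mathfrak m)^{\times}|$ (so $\varphi_{\mathfrak D}(\mathfrak D)=1$), and, for $a$ with $\langle a\rangle+\mathfrak m=\mathfrak D$, let $\mathrm{ord}(a,\mathfrak m)$ be the least integer $i\ge 1$ with $a^i-1\in\mathfrak m$. **Graphs and trees.** The functional graph $\mathcal G(f)$ of a map $f:X\to X$ has vertex set $X$ and the directed edges $(x,f(x))$, $x\in X$. We write $\oplus$ for disjoint union, $k\times G$ for the disjoint union of $k$ copies of $G$, $\bullet$ for the one-vertex rooted tree, and $\langle T_1\oplus\dots\oplus T_k\rangle$ for the rooted tree whose root has exactly $k$ predecessors, the $i$-th of which is the root of a copy of the rooted tree $T_i$ (edges point towards the root). $\mathrm{Cyc}(m,T)$ is a directed cycle of length $m\ge 1$ every node of which is the root of a copy of the rooted tree $T$. For integers $\nu_1\ge\nu_2\ge\dots\ge\nu_d\ge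 1$ with $d\ge 1$ and $V=(\nu_1,\dots,\nu_d)$, put $T_V^0=\bullet$, $$T_V^k=\Big\langle \nu_k\times T_V^{k-1}\oplus\bigoplus_{i=1}^{k-1}(\nu_i-\nu_{i+1})\times T_V^{i-1}\Big\rangle\quad(1\le k<d),\qquad T_V=\Big\langle (\nu_d-1)\times T_V^{d-1}\oplus\bigoplus_{i=1}^{d-1}(\nu_i-\nu_{i+1})\times T_V^{i-1}\Big\rangle .$$ **$\nu$-series.** For $a\ne 0$ and a nonzero ideal $\mathfrak n_0$ with $\langle a\rangle\subseteq\mathrm{rad}(\mathfrak n_0)$, put $\mathfrak a_1=\gcd(\mathfrak n_0,\langle a\rangle)$ and $\mathfrak a_{i+1}=\gcd\big(\mathfrak n_0/(\mathfrak a_1\cdots\mathfrak a_i),\langle a\rangle\big)$, where $\gcd(\mathfrak b,\mathfrak c)=\mathfrak b+\mathfrak c$. The $\nu$-series of $\mathfrak n_0$ with respect to $a$ is $\mathfrak n_0(a)=(N(\mathfrak a_1),\dots,N(\mathfrak a_d))$, where $d$ is the least positive integer with $\mathfrak a_1\cdots\mathfrak a_d=\mathfrak n_0$. **Theorem.** Let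 $a\in\mathfrak D$ be nonzero, let $\mathfrak n$ be a nonzero ideal of $\mathfrak D$, and let $\mathfrak n=\mathfrak n_0\mathfrak n_1$ be the $a$-decomposition of $\mathfrak n$, that is, $\langle a\rangle\subseteq\mathrm{rad}(\mathfrak n_0)$ and $\mathfrak n_1+\langle a\rangle=\mathfrak D$. Then $\mathfrak n_0(a)$ is a well-defined nonempty non-increasing sequence of positive integers; for every ideal $\mathfrak m\mid\mathfrak n_1$ the order $\mathrm{ord}(a,\mathfrak m)$ exists and divides $\varphi_{\mathfrak D}(\mathfrak m)$; and the functional graph of the map $\Gamma_{a,\mathfrak n}:\mathfrak D/\mathfrak n\to\mathfrak D/\mathfrak n$, $x\mapsto ax$, satisfies $$\mathcal G(\Gamma_{a,\mathfrak n})\;\cong\;\bigoplus_{\mathfrak m\mid\mathfrak n_1}\frac{\varphi_{\mathfrak D}(\mathfrak m)}{\mathrm{ord}(a,\mathfrak m)}\times\mathrm{Cyc}\big(\mathrm{ord}(a,\mathfrak m),\,T_{\mathfrak n_0(a)}\big),$$ where $\mathfrak m$ runs over the ideals of $\mathfrak D$ dividing $\mathfrak n_1$. -/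

import Mathlib

namespace AMap

/-! ### Directed graphs -/

/-- Isomorphisms of directed graphs: bijections on vertices preserving and reflecting edges. -/
abbrev DigraphIso {V W : Type*} (G : Digraph V) (H : Digraph W) : Type _ :=
  G.Adj ≃r H.Adj

/-- The functional graph of a self-map: the edges are the pairs `(x, f x)`. -/
def functionalGraph {X : Type*} (f : X → X) : Digraph X where
  Adj x y := f x = y

/-- The disjoint union of a family of directed graphs. -/
def disjointUnion {ι : Type*} {V : ι → Type*} (G : ∀ i, Digraph (V i)) : Digraph (Σ i, V i) where
  Adj x y := ∃ (i : ι) (v w : V i), x = ⟨i, v⟩ ∧ y = ⟨i, w⟩ ∧ (G i).Adj v w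

/-- The disjoint union of `k` copies of a directed graph. -/
def copies (k : ℕ) {V : Type*} (G : Digraph V) : Digraph (Σ _ : Fin k, V) :=
  disjointUnion fun _ : Fin k => G

/-! ### Finite rooted trees -/

/-- Finite rooted trees: a root with finitely many (say `k`) predecessors,
the `i`-th of which is the root of the tree `c i`. -/
inductive FinRootedTree : Type
  | node (k : ℕ) (c : Fin k → FinRootedTree) : FinRootedTree

namespace FinRootedTree

/-- The vertices of a rooted tree: the root, and the vertices of the trees below it. -/
def Vertex : FinRootedTree → Type
  | node k c => Option (Σ i : Fin k, (c i).Vertex)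

/-- The root of a rooted tree. -/
def root : (T : FinRootedTree) → T.Vertex
  | node _ _ => (none : Option _)

/-- The vertex that comes after a given vertex on the way to the root (none for the root).
The root of the `i`-th tree below the root is sent to the root; any other vertex of the `i`-th tree
is sent to its parent in the `i`-th tree. -/
def parent : (T : FinRootedTree) → T.Vertex → Option T.Vertex
  | node _ _, none => none
  | node _ c, some ⟨i, v⟩ => some ((parent (c i) v).map fun w => ⟨i, w⟩)

/-- A rooted tree as a directed graph, with all edges pointing towards the root. -/
def graph (T : FinRootedTree) : Digraph T.Vertex where
  Adj v w := T.parent v = some w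

/-- For a forest `G`, given as the list of its trees, the tree `⟨G⟩` whose root has as predecessors
exactly the roots of the trees of `G`. -/
def join (G : List FinRootedTree) : FinRootedTree :=
  node G.length G.get

/-- The tree with a single vertex. -/
def bullet : FinRootedTree := join []

end FinRootedTree

open FinRootedTree

/-- `Cyc(m, T)`: a directed cycle of length `m`, each of whose nodes is the root of a copy
of `T`. The vertex `(i, v)` is the vertex `v` of the `i`-th copy. -/
def cyc (m : ℕ) (T : FinRootedTree) : Digraph (Fin m × T.Vertex) where
  Adj x y :=
    (x.1 = y.1 ∧ T.graph.Adj x.2 y.2) ∨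
      (x.2 = T.root ∧ y.2 = T.root ∧ (y.1 : ℕ) = ((x.1 : ℕ) + 1) % m)

/-! ### Elementary trees

A sequence `(ν₁, …, ν_d)` is a list `V`, so that `ν_{i+1}` is `V.getD i 0` for `i < d`. -/

/-- The sequences to which a tree is associated: `ν₁ ≥ ν₂ ≥ ⋯ ≥ ν_d ≥ 1` with `d ≥ 1`. -/
def IsTreeSequence (V : List ℕ) : Prop :=
  V ≠ [] ∧ V.Pairwise (· ≥ ·) ∧ ∀ x ∈ V, 1 ≤ x

/-- The trees `T_V^k`: `T_V^0` is a single vertex, and `T_V^k` for `k ≥ 1` is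
`⟨ν_k × T_V^{k-1} ⊕ ⨁_{i=1}^{k-1} (ν_i - ν_{i+1}) × T_V^{i-1}⟩`. -/
def partialTree (V : List ℕ) : ℕ → FinRootedTree
  | 0 => bullet
  | k + 1 => join (List.replicate (V.getD k 0) (partialTree V k) ++
      (List.ofFn fun i : Fin k =>
        List.replicate (V.getD i 0 - V.getD (i + 1) 0) (partialTree V i)).flatten)
  decreasing_by all_goals omega

/-- The elementary tree
`T_V = ⟨(ν_d - 1) × T_V^{d-1} ⊕ ⨁_{i=1}^{d-1} (ν_i - ν_{i+1}) × T_V^{i-1}⟩`. -/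
def elementaryTree (V : List ℕ) : FinRootedTree :=
  join (List.replicate (V.getD (V.length - 1) 0 - 1) (partialTree V (V.length - 1)) ++
    (List.ofFn fun i : Fin (V.length - 1) =>
      List.replicate (V.getD i 0 - V.getD (i + 1) 0) (partialTree V i)).flatten)

/-! ### Ideals -/

section Ideals

variable {D : Type*} [CommRing D]

/-- The norm of an ideal: the number of residue classes. -/
noncomputable def idealNorm (I : Ideal D) : ℕ := Nat.card (D ⧸ I)

/-- The Euler function of an ideal: the number of units of the residue class ring. It is `1` at
the unit ideal, where the residue class ring is trivial. -/
noncomputable def idealPhi (I : Ideal D) : ℕ := Nat.card (D ⧸ I)ˣ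

/-- The order of `a` modulo `I`: the least `i ≥ 1` with `a ^ i ≡ 1` modulo `I`. -/
noncomputable def ordMod (a : D) (I : Ideal D) : ℕ := sInf {i : ℕ | 0 < i ∧ a ^ i - 1 ∈ I}

/-- The map `x ↦ a x` on `D ⧸ n`. -/
def aMap (a : D) (n : Ideal D) : D ⧸ n → D ⧸ n := fun x => Ideal.Quotient.mk n a * x

/-- `n = n₀ n₁` is the `a`-decomposition of `n`. -/
def IsADecomposition (a : D) (n n₀ n₁ : Ideal D) : Prop :=
  n = n₀ * n₁ ∧ Ideal.span {a} ≤ n₀.radical ∧ n₁ ⊔ Ideal.span {a} = ⊤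

/-- The quotient `I / J` of an ideal by a divisor, in the form of the ideal quotient
`{x | x J ⊆ I}`. -/
def idealQuotient (I J : Ideal D) : Ideal D := Submodule.colon I (J : Set D)

/-- In a Dedekind domain, `I / J` is the cofactor of `J` whenever `J` is a nonzero divisor
of `I`. -/
theorem idealQuotient_mul_left [IsDedekindDomain D] {J : Ideal D} (hJ : J ≠ ⊥) (K : Ideal D) :
    idealQuotient (J * K) J = K := by
  ext x
  rw [idealQuotient, Submodule.mem_colon]
  constructor
  · intro h
    have h1 : J * Ideal.span {x} ≤ J * K := by
      rw [Ideal.mul_le]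
      intro r hr s hs
      obtain ⟨t, rfl⟩ := Ideal.mem_span_singleton'.1 hs
      have := Ideal.mul_mem_left (J * K) t (h r hr)
      simpa [smul_eq_mul, mul_comm, mul_left_comm, mul_assoc] using this
    have h2 : K ∣ Ideal.span {x} :=
      (mul_dvd_mul_iff_left (by simpa using hJ)).1 (Ideal.dvd_iff_le.2 h1)
    exact (Ideal.span_singleton_le_iff_mem K).1 (Ideal.dvd_iff_le.1 h2)
  · intro hx y hy
    have h := Ideal.mul_mem_mul hy hx
    rwa [mul_comm y x] at h

/-- The product `𝔞₁ ⋯ 𝔞_k` of the first `k` ideals `𝔞_{i+1} = gcd(n₀ / (𝔞₁ ⋯ 𝔞_i), ⟨a⟩)`;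
the gcd of two ideals is their sum. -/
def nuProd (n₀ : Ideal D) (a : D) : ℕ → Ideal D
  | 0 => 1
  | k + 1 => nuProd n₀ a k * (idealQuotient n₀ (nuProd n₀ a k) ⊔ Ideal.span {a})

/-- The ideal `𝔞_{k+1} = gcd(n₀ / (𝔞₁ ⋯ 𝔞_k), ⟨a⟩)`. -/
def nuIdeal (n₀ : Ideal D) (a : D) (k : ℕ) : Ideal D :=
  idealQuotient n₀ (nuProd n₀ a k) ⊔ Ideal.span {a}

/-- The least positive integer `d` with `𝔞₁ ⋯ 𝔞_d = n₀` (and `0` if there is none). -/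
noncomputable def nuLength (n₀ : Ideal D) (a : D) : ℕ := sInf {d : ℕ | 0 < d ∧ nuProd n₀ a d = n₀}

/-- The `ν`-series `n₀(a) = (N(𝔞₁), …, N(𝔞_d))`. -/
noncomputable def nuSeries (n₀ : Ideal D) (a : D) : List ℕ :=
  (List.range (nuLength n₀ a)).map fun k => idealNorm (nuIdeal n₀ a k)

end Ideals

end AMap

/-! Since a power of `a` lies in `n₀` while `a` is prime to `n₁`, the Chinese remainder theorem
splits multiplication by `a` into a nilpotent map `f` on `M = D ⧸ n₀` and a permutation `π` of `D ⧸
n₁`.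

Let `δ x` be the number of steps that `f` needs to take `x` to 0. The twist `(x, y) ↦ (x, π^(δ x)
y)` turns `f × π` into a map that leaves the second coordinate alone while `x ≠ 0` and applies `π`
when `x = 0`. So the graph consists of the cycles of `π`, with the tree of `f` at 0 attached to
every node (`nonempty_iso_of_realizes`).

Cycles: sort `D ⧸ n₁` by annihilator. The elements with annihilator `m` correspond to `(D ⧸ m)ˣ`, on
which `a` acts as translation by a unit, so each cycle has the length of the order of that unit
(`exists_equiv_sigma_units`, `exists_equiv_fin_prod_fin`).

Tree: call the largest `i` with `x ∈ a^i M` the height of a nonzero `x`. A point of `a^(k+1) M` has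
exactly `|ker a ∩ a^k M|` predecessors in `a^k M`, whichever point it is. Hence the number of
predecessors of each height, and by induction the whole tree above a nonzero point, depends only on
the height; this is the recursion for `T_V^k`. At 0 one predecessor is lost, namely 0 itself.
Finally `|ker a ∩ a^k M| = [a^k M : a^(k+1) M]` is the norm of the ideal `𝔞_{k+1}`
(`idealNorm_nuIdeal`). -/

namespace AMap

open FinRootedTree

/-! ### Realizing rooted trees by iterating a self-map -/

section Realizes

variable {X : Type*}

/-- The tree `T` describes the iterated predecessors of `x` under `f`, where the point `r` does not
count as a predecessor. -/
def Realizes (f : X → X) (r : X) : FinRootedTree → X → Prop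
  | node k c, x => ∃ p : Fin k → X, Function.Injective p ∧
      (∀ y, (∃ i, p i = y) ↔ f y = x ∧ y ≠ r) ∧ ∀ i, Realizes f r (c i) (p i)

theorem FinRootedTree.parent_root (T : FinRootedTree) : T.parent T.root = none := by
  cases T; rfl

theorem FinRootedTree.eq_root_of_parent_eq_none {T : FinRootedTree} {v : T.Vertex}
    (h : T.parent v = none) : v = T.root := by
  cases T with
  | node k c =>
    cases v with
    | none => rfl
    | some s => simp [parent] at h

/-- A realized tree embeds onto the set of iterated predecessors of the point realizing it. The
depth function `δ` counts the steps needed to reach `r`. -/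
theorem Realizes.exists_embedding {f : X → X} {r : X} {δ : X → ℕ} (hr : δ r = 0)
    (hδ : ∀ x, x ≠ r → δ x = δ (f x) + 1) {T : FinRootedTree} {x : X} (h : Realizes f r T x) :
    ∃ φ : T.Vertex → X, Function.Injective φ ∧ φ T.root = x ∧
      (∀ y, (∃ v, φ v = y) ↔ δ x ≤ δ y ∧ f^[δ y - δ x] y = x) ∧
      ∀ v w, T.parent v = some w → f (φ v) = φ w := by
  induction T generalizing x with
  | node k c ih =>
    obtain ⟨p, hp, hpre, hc⟩ := h
    choose φ hinj hroot hran hpar using fun i => ih i (hc i)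
    have hpi : ∀ i, f (p i) = x ∧ p i ≠ r := fun i => (hpre _).1 ⟨i, rfl⟩
    have hδp : ∀ i, δ (p i) = δ x + 1 := fun i => by rw [hδ _ (hpi i).2, (hpi i).1]
    let Φ : Option (Σ i : Fin k, (c i).Vertex) → X
      | none => x
      | some ⟨i, v⟩ => φ i v
    -- The image of a vertex determines its branch: iterating down to depth `δ x + 1` recovers `p
    -- i`.
    have hmem : ∀ i v, δ x + 1 ≤ δ (φ i v) ∧ f^[δ (φ i v) - (δ x + 1)] (φ i v) = p i := by
      intro i v
      have := (hran i _).1 ⟨v, rfl⟩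
      rwa [hδp] at this
    refine ⟨Φ, ?_, rfl, ?_, ?_⟩
    · rintro (_ | ⟨i, v⟩) (_ | ⟨j, w⟩) hvw
      · rfl
      · have h1 := (hmem j w).1
        have h2 : x = φ j w := hvw
        rw [← h2] at h1; omega
      · have h1 := (hmem i v).1
        have h2 : φ i v = x := hvw
        rw [h2] at h1; omega
      · have h2 : φ i v = φ j w := hvw
        have h3 : p i = p j := by rw [← (hmem i v).2, ← (hmem j w).2, h2]
        obtain rfl := hp h3
        rw [hinj i h2]
    · intro y
      constructor
      · rintro ⟨_ | ⟨i, v⟩, rfl⟩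
        · exact ⟨le_rfl, by simp [Φ]⟩
        · have h1 := hmem i v
          refine ⟨by simp only [Φ]; omega, ?_⟩
          change f^[δ (φ i v) - δ x] (φ i v) = x
          rw [show δ (φ i v) - δ x = (δ (φ i v) - (δ x + 1)) + 1 by omega,
            Function.iterate_succ_apply', h1.2, (hpi i).1]
      · rintro ⟨h1, h2⟩
        rcases Nat.eq_or_lt_of_le h1 with h3 | h3
        · refine ⟨none, ?_⟩
          rw [h3, Nat.sub_self] at h2
          exact h2.symm
        · have hit : ∀ j y, j ≤ δ y → δ (f^[j] y) = δ y - j := by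
            intro j
            induction j with
            | zero => intro y _; simp
            | succ j ihj =>
              intro y hy
              have hyr : y ≠ r := by rintro rfl; omega
              have := hδ y hyr
              rw [Function.iterate_succ_apply, ihj _ (by omega)]
              omega
          -- The iterate of `y` just before `x` has depth `δ x + 1 > 0`, so it is not `r` and must
          -- be some `p i`.
          obtain ⟨i, hi⟩ := (hpre (f^[δ y - (δ x + 1)] y)).2 ⟨by
            rw [← Function.iterate_succ_apply' f,
              show (δ y - (δ x + 1)).succ = δ y - δ x by omega, h2], by
            intro h4
            have := hit (δ y - (δ x + 1)) y (by omega)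
            rw [h4, hr] at this; omega⟩
          obtain ⟨v, hv⟩ := (hran i y).2 ⟨by rw [hδp]; omega, by rw [hδp, hi]⟩
          exact ⟨some ⟨i, v⟩, hv⟩
    · rintro (_ | ⟨i, v⟩) w hw
      · simp [parent] at hw
      · cases hv : (c i).parent v with
        | none =>
          simp only [parent, hv, Option.map_none] at hw
          obtain rfl : none = w := Option.some.inj hw
          obtain rfl := eq_root_of_parent_eq_none hv
          change f (φ i (c i).root) = x
          rw [hroot, (hpi i).1]
        | some u =>
          simp only [parent, hv, Option.map_some] at hw
          obtain rfl : some ⟨i, u⟩ = w := Option.some.inj hw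
          exact hpar i v u hv

/-- Used to reorder the predecessors of a point so that their trees appear in the order prescribed
by a joined forest. -/
theorem exists_map_eq_of_perm_map {α β : Type*} {t : α → β} {l : List α} {L : List β}
    (h : L.Perm (l.map t)) : ∃ l' : List α, l'.Perm l ∧ l'.map t = L := by
  have h' : Relation.Comp (· = List.map t ·) List.Perm L l := by
    rw [List.eq_map_comp_perm]; exact h
  obtain ⟨l', h1, h2⟩ := h'
  exact ⟨l', h2, h1.symm⟩

/-- A point realizes a joined forest when its trees match the predecessors of the point. -/
theorem Realizes.join {f : X → X} {r x : X} (P : Finset X) (hP : ∀ y, y ∈ P ↔ f y = x ∧ y ≠ r)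
    (t : X → FinRootedTree) (ht : ∀ y ∈ P, Realizes f r (t y) y) {L : List FinRootedTree}
    (hL : L.Perm (P.toList.map t)) : Realizes f r (FinRootedTree.join L) x := by
  obtain ⟨l, hl, rfl⟩ := exists_map_eq_of_perm_map hL
  have hnd : l.Nodup := hl.nodup_iff.2 P.nodup_toList
  have hlen : (l.map t).length = l.length := List.length_map _
  have hmem : ∀ y, y ∈ l ↔ f y = x ∧ y ≠ r := fun y => by
    rw [hl.mem_iff, Finset.mem_toList, hP]
  refine ⟨fun i => l.get (i.cast hlen), ?_, ?_, ?_⟩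
  · intro i j hij
    exact Fin.cast_injective hlen (hnd.injective_get hij)
  · intro y
    rw [← hmem, List.mem_iff_get]
    exact ⟨fun ⟨i, hi⟩ => ⟨_, hi⟩, fun ⟨i, hi⟩ => ⟨i.cast hlen.symm, hi⟩⟩
  · intro i
    have : (l.map t).get i = t (l.get (i.cast hlen)) := by simp
    rw [this]
    exact ht _ ((hP _).2 ((hmem _).1 (List.get_mem _ _)))

/-- The list with `c` copies of `τ K` and `g i` copies of `τ i` for `i < K` lists the values of
`τ ∘ ht` over a finite set whose level sets for `ht` have these sizes. -/
theorem levels_perm {β : Type*} (P : Finset X) (ht : X → ℕ) (τ : ℕ → β) (K c : ℕ) (g : ℕ → ℕ)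
    (hle : ∀ y ∈ P, ht y ≤ K) (hc : (P.filter fun y => ht y = K).card = c)
    (hg : ∀ i < K, (P.filter fun y => ht y = i).card = g i) :
    (List.replicate c (τ K) ++
      (List.ofFn fun i : Fin K => List.replicate (g i) (τ i)).flatten).Perm
      (P.toList.map fun y => τ (ht y)) := by
  -- Compare lists of heights, where multiplicities can be counted, and only then apply `τ`, which
  -- need not be injective.
  have key : (List.replicate c K ++
      (List.ofFn fun i : Fin K => List.replicate (g i) (i : ℕ)).flatten).Perm
      (P.toList.map ht) := by
    rw [List.perm_iff_count]
    intro j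
    have h1 : (P.toList.map ht).count j = (P.filter fun y => ht y = j).card := by
      rw [← Multiset.coe_count, ← Multiset.map_coe, Finset.coe_toList, Multiset.count_map,
        Finset.card_def, Finset.filter_val]
      simp only [eq_comm]
    have h2 : (List.ofFn fun i : Fin K => List.replicate (g i) (i : ℕ)).flatten.count j =
        if j < K then g j else 0 := by
      rw [List.count_flatten, List.map_ofFn, List.sum_ofFn]
      simp only [Function.comp_apply, List.count_replicate, beq_iff_eq]
      split_ifs with hj
      · rw [Finset.sum_eq_single (⟨j, hj⟩ : Fin K)]
        · simp
        · intro b _ hb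
          rw [if_neg]
          rintro rfl
          exact hb rfl
        · simp
      · refine Finset.sum_eq_zero fun b _ => ?_
        rw [if_neg]
        have := b.2
        omega
    rw [List.count_append, h1, h2, List.count_replicate]
    simp only [beq_iff_eq]
    rcases lt_trichotomy j K with hj | rfl | hj
    · rw [if_neg (by omega), if_pos hj, hg j hj, zero_add]
    · rw [if_pos rfl, if_neg (lt_irrefl _), hc, add_zero]
    · rw [if_neg (by omega), if_neg (by omega), eq_comm, zero_add, Finset.card_eq_zero,
        Finset.filter_eq_empty_iff]
      intro y hy h
      have := hle y hy
      omega
  have := key.map τ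
  rw [List.map_map, List.map_append, List.map_replicate, List.map_flatten, List.map_ofFn] at this
  simpa only [Function.comp_def, List.map_replicate] using this

theorem partialTree_succ (V : List ℕ) (k : ℕ) : partialTree V (k + 1) =
    FinRootedTree.join (List.replicate (V.getD k 0) (partialTree V k) ++
      (List.ofFn fun i : Fin k =>
        List.replicate (V.getD i 0 - V.getD (i + 1) 0) (partialTree V i)).flatten) := by
  rw [partialTree]

/-! ### Trees of self-maps whose fibre sizes depend only on the height -/

section Iterate

theorem range_iterate_antitone (f : X → X) : Antitone fun k => Set.range f^[k] := by
  refine antitone_nat_of_succ_le fun k => ?_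
  rintro _ ⟨y, rfl⟩
  exact ⟨f y, rfl⟩

variable [Finite X] {f : X → X} {r : X} {V : List ℕ}

/-- The trees hanging at the points of the image of the `k`-th but not of the next iterate. -/
theorem realizes_partialTree (hfr : f r = r)
    (hV : ∀ k < V.length, ∀ x ∈ Set.range f^[k + 1],
      {y ∈ Set.range f^[k] | f y = x}.ncard = V.getD k 0)
    {ht : X → ℕ} (hht : ∀ y, y ≠ r → ∀ i, y ∈ Set.range f^[i] ↔ i ≤ ht y)
    (hlen : ∀ y, y ≠ r → ht y < V.length) (k : ℕ) :
    ∀ x, x ≠ r → ht x = k → Realizes f r (partialTree V k) x := by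
  induction k using Nat.strong_induction_on with
  | _ k ih =>
  intro x hx hk
  have hkl := hlen x hx
  have hpred : ∀ y, f y = x → y ≠ r := by
    rintro y hy rfl
    exact hx (hy.symm.trans hfr)
  have hlt : ∀ y, f y = x → ht y < k := by
    intro y hy
    obtain ⟨z, hz⟩ := (hht y (hpred y hy) (ht y)).2 le_rfl
    have : x ∈ Set.range f^[ht y + 1] := ⟨z, by rw [Function.iterate_succ_apply', hz, hy]⟩
    rw [hht x hx, hk] at this
    omega
  cases k with
  | zero =>
    rw [partialTree, bullet]
    refine Realizes.join ∅ (fun y => ?_) (fun _ => bullet) (by simp) (by simp)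
    simp only [Finset.notMem_empty, false_iff]
    rintro ⟨hy, -⟩
    exact absurd (hlt y hy) (by omega)
  | succ k =>
    classical
    have := Fintype.ofFinite X
    rw [partialTree_succ]
    set P : Finset X := Finset.univ.filter fun y => f y = x with hP
    -- The hypothesis `hV` counts predecessors of height at least `i`; exact heights come from
    -- differences of consecutive counts.
    have hcard : ∀ i ≤ k, (P.filter fun y => i ≤ ht y).card = V.getD i 0 := by
      intro i hi
      rw [← hV i (by omega) x ((hht x hx _).2 (by omega)), ← Set.ncard_coe_finset]
      congr 1
      ext y
      simp only [hP, Finset.coe_filter, Finset.mem_filter, Finset.mem_univ, true_and,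
        Set.mem_ofPred_eq]
      constructor
      · rintro ⟨h1, h2⟩
        exact ⟨(hht y (hpred y h1) i).2 h2, h1⟩
      · rintro ⟨h1, h2⟩
        exact ⟨h2, (hht y (hpred y h2) i).1 h1⟩
    refine Realizes.join P (fun y => ?_) (fun y => partialTree V (ht y)) (fun y hy => ?_)
      (levels_perm P ht (partialTree V) k _ (fun i => V.getD i 0 - V.getD (i + 1) 0) ?_ ?_ ?_)
    · simp only [hP, Finset.mem_filter, Finset.mem_univ, true_and]
      exact ⟨fun h => ⟨h, hpred y h⟩, And.left⟩
    · have hy' : f y = x := by simpa [hP] using hy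
      exact ih _ (hlt y hy') y (hpred y hy') rfl
    · intro y hy
      have hy' : f y = x := by simpa [hP] using hy
      have := hlt y hy'
      omega
    · rw [← hcard k le_rfl]
      congr 1
      refine Finset.filter_congr fun y hy => ?_
      have hy' : f y = x := by simpa [hP] using hy
      have := hlt y hy'
      omega
    · intro i hi
      rw [← hcard i (by omega), ← hcard (i + 1) (by omega), ← Finset.card_sdiff_of_subset]
      · congr 1
        ext y
        simp only [Finset.mem_filter, Finset.mem_sdiff]
        grind
      · intro y
        simp only [Finset.mem_filter]
        grind

/-- The tree hanging at the fixed point of a nilpotent self-map. -/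
theorem realizes_elementaryTree (hfr : f r = r) (hne : V ≠ [])
    (hnil : ∀ x, f^[V.length] x = r)
    (hV : ∀ k < V.length, ∀ x ∈ Set.range f^[k + 1],
      {y ∈ Set.range f^[k] | f y = x}.ncard = V.getD k 0) :
    Realizes f r (elementaryTree V) r := by
  classical
  have := Fintype.ofFinite X
  set d := V.length with hd
  have hd1 : 0 < d := List.length_pos_iff.2 hne
  have hfr' : ∀ i, f^[i] r = r := fun i => Function.iterate_fixed hfr i
  -- The search bound `d` loses nothing for `y ≠ r`, because the `d`-th iterate has image `{r}`. At
  -- `r` the value is never used.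
  set ht : X → ℕ := fun y => Nat.findGreatest (fun i => y ∈ Set.range f^[i]) d with hhtd
  have hlast : ∀ y, y ≠ r → ∀ i, y ∈ Set.range f^[i] → i < d := by
    intro y hy i hi
    by_contra! hlt
    obtain ⟨z, hz⟩ := range_iterate_antitone f hlt hi
    exact hy (hz.symm.trans (hnil z))
  have hht : ∀ y, y ≠ r → ∀ i, y ∈ Set.range f^[i] ↔ i ≤ ht y := by
    intro y hy i
    constructor
    · intro hi
      exact Nat.le_findGreatest (hlast y hy i hi).le hi
    · intro hi
      refine range_iterate_antitone f hi ?_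
      exact Nat.findGreatest_spec (P := fun i => y ∈ Set.range f^[i]) (Nat.zero_le d) ⟨y, rfl⟩
  have hlt : ∀ y, y ≠ r → ht y < d := fun y hy => hlast y hy _ ((hht y hy _).2 le_rfl)
  set P : Finset X := Finset.univ.filter fun y => f y = r ∧ y ≠ r with hP
  -- The fixed point `r` lies in every image and in its own fibre, but is not a child in the tree.
  have hcard : ∀ i < d, (P.filter fun y => i ≤ ht y).card = V.getD i 0 - 1 := by
    intro i hi
    have h1 : r ∈ {y ∈ Set.range f^[i] | f y = r} := ⟨⟨r, hfr' i⟩, hfr⟩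
    rw [← hV i hi r ⟨r, hfr' _⟩, ← Set.ncard_sdiff_singleton_of_mem h1, ← Set.ncard_coe_finset]
    congr 1
    ext y
    simp only [hP, Finset.coe_filter, Finset.mem_filter, Finset.mem_univ, true_and,
      Set.mem_ofPred_eq, Set.mem_sdiff, Set.mem_singleton_iff]
    constructor
    · rintro ⟨⟨h1, h2⟩, h3⟩
      exact ⟨⟨(hht y h2 i).2 h3, h1⟩, h2⟩
    · rintro ⟨⟨h1, h2⟩, h3⟩
      exact ⟨⟨h2, h3⟩, (hht y h3 i).1 h1⟩
  refine Realizes.join P (fun y => ?_) (fun y => partialTree V (ht y)) (fun y hy => ?_)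
      (levels_perm P ht (partialTree V) (d - 1) _ (fun i => V.getD i 0 - V.getD (i + 1) 0)
        ?_ ?_ ?_)
  · simp [hP]
  · have hy' : f y = r ∧ y ≠ r := by simpa [hP] using hy
    exact realizes_partialTree hfr hV hht hlt _ y hy'.2 rfl
  · intro y hy
    have hy' : f y = r ∧ y ≠ r := by simpa [hP] using hy
    have := hlt y hy'.2
    omega
  · rw [← hcard _ (by omega)]
    congr 1
    refine Finset.filter_congr fun y hy => ?_
    have hy' : f y = r ∧ y ≠ r := by simpa [hP] using hy
    have := hlt y hy'.2
    omega
  · intro i hi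
    -- Positivity is needed for the two `- 1` to cancel in truncated subtraction.
    have h0 : 1 ≤ V.getD (i + 1) 0 := by
      rw [← hV (i + 1) (by omega) r ⟨r, hfr' _⟩, Nat.one_le_iff_ne_zero]
      exact Set.ncard_ne_zero_of_mem (a := r) ⟨⟨r, hfr' _⟩, hfr⟩ (Set.toFinite _)
    have h2 := hcard i (by omega)
    have h3 := hcard (i + 1) (by omega)
    have h4 : (P.filter fun y => ht y = i) =
        (P.filter fun y => i ≤ ht y) \ P.filter fun y => i + 1 ≤ ht y := by
      ext y
      simp only [Finset.mem_filter, Finset.mem_sdiff]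
      grind
    rw [h4, Finset.card_sdiff_of_subset, h2, h3]
    · omega
    · intro y
      simp only [Finset.mem_filter]
      grind

end Iterate

end Realizes

/-! ### Products of a tree with a permutation -/

section Product

/-- The map whose graph is the disjoint union of copies of `Cyc (o i, T)`. -/
def cycStep {ι : Type*} {q o : ι → ℕ} (T : FinRootedTree) :
    (Σ i, Σ _ : Fin (q i), Fin (o i) × T.Vertex) → Σ i, Σ _ : Fin (q i), Fin (o i) × T.Vertex
  | ⟨i, j, c, v⟩ => match T.parent v with
    | some w => ⟨i, j, c, w⟩
    | none => ⟨i, j, ⟨(c + 1) % o i, Nat.mod_lt _ c.pos⟩, v⟩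

theorem cyc_adj_iff {m : ℕ} {T : FinRootedTree} (c c' : Fin m) (v v' : T.Vertex) :
    (cyc m T).Adj (c, v) (c', v') ↔
      (c', v') = match T.parent v with
        | some w => (c, w)
        | none => (⟨(c + 1) % m, Nat.mod_lt _ c.pos⟩, v) := by
  cases h : T.parent v with
  | some w =>
    have hv : v ≠ T.root := by rintro rfl; simp [parent_root] at h
    simp only [cyc, graph, h, hv, false_and, or_false, Prod.mk.injEq, Option.some.injEq]
    exact ⟨fun ⟨h1, h2⟩ => ⟨h1.symm, h2.symm⟩, fun ⟨h1, h2⟩ => ⟨h1.symm, h2.symm⟩⟩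
  | none =>
    obtain rfl := eq_root_of_parent_eq_none h
    simp only [cyc, graph, h, Prod.mk.injEq, Fin.ext_iff]
    simp
    exact and_comm

/-- The target is itself a functional graph, so an isomorphism amounts to a bijection intertwining
the two maps. -/
theorem adj_iff_cycStep {ι : Type*} {q o : ι → ℕ} {T : FinRootedTree}
    (x y : Σ i, Σ _ : Fin (q i), Fin (o i) × T.Vertex) :
    (disjointUnion fun i => copies (q i) (cyc (o i) T)).Adj x y ↔ y = cycStep T x := by
  obtain ⟨i, j, c, v⟩ := x
  have key : (disjointUnion fun i => copies (q i) (cyc (o i) T)).Adj ⟨i, j, c, v⟩ y ↔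
      ∃ c' v', y = ⟨i, j, c', v'⟩ ∧ (cyc (o i) T).Adj (c, v) (c', v') := by
    constructor
    · rintro ⟨i, ⟨_, _⟩, ⟨_, c', v'⟩, hx, rfl, j, s, ⟨_, _⟩, hv, hw, h⟩
      cases hv
      cases hw
      cases hx
      exact ⟨c', v', rfl, h⟩
    · rintro ⟨c', v', rfl, h⟩
      exact ⟨i, _, _, rfl, rfl, j, _, _, rfl, rfl, h⟩
  rw [key]
  simp only [cyc_adj_iff, cycStep]
  cases T.parent v with
  | some w => simp
  | none => simp

/-- The product of a self-map of tree type and of a permutation consisting of `q i` cycles of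
length `o i`, for each `i`. -/
theorem nonempty_iso_of_realizes {X Y ι : Type*} {f : X → X} {r : X} {T : FinRootedTree}
    (hfr : f r = r) (hnil : ∀ x, ∃ k, f^[k] x = r) (hT : Realizes f r T r)
    (π : Equiv.Perm Y) {q o : ι → ℕ} (ψ : Y ≃ Σ i, Fin (q i) × Fin (o i))
    (hψ : ∀ y, ψ (π y) = ⟨(ψ y).1, (ψ y).2.1,
      ⟨((ψ y).2.2 + 1) % o (ψ y).1, Nat.mod_lt _ (ψ y).2.2.pos⟩⟩) :
    Nonempty (DigraphIso (functionalGraph (Prod.map f π))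
      (disjointUnion fun i => copies (q i) (cyc (o i) T))) := by
  classical
  set δ : X → ℕ := fun x => Nat.find (hnil x) with hδdef
  have hr : δ r = 0 := by rw [hδdef]; simp
  have hδ : ∀ x, x ≠ r → δ x = δ (f x) + 1 := by
    intro x hx
    refine (Nat.find_comp_succ (hnil x) (hnil (f x)) ?_)
    exact hx
  obtain ⟨φ, hinj, hroot, hran, hpar⟩ := hT.exists_embedding hr hδ
  have hsurj : Function.Surjective φ := fun y => (hran y).2 ⟨by omega, by
    rw [hr]; exact Nat.find_spec (hnil y)⟩
  let e : T.Vertex ≃ X := Equiv.ofBijective φ ⟨hinj, hsurj⟩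
  let pack : X → (Σ i, Fin (q i) × Fin (o i)) → Σ i, Σ _ : Fin (q i), Fin (o i) × T.Vertex :=
    fun x z => ⟨z.1, z.2.1, z.2.2, e.symm x⟩
  -- The twist by `π ^ δ`: off `r`, `δ` drops by one while `π` is applied once, so the cycle
  -- position stays fixed; at `r`, `δ` is 0 and the position advances.
  let E : X × Y ≃ Σ i, Σ _ : Fin (q i), Fin (o i) × T.Vertex :=
    { toFun := fun p => pack p.1 (ψ ((π ^ δ p.1) p.2))
      invFun := fun s => (e s.2.2.2,
        (π ^ δ (e s.2.2.2)).symm (ψ.symm ⟨s.1, s.2.1, s.2.2.1⟩))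
      left_inv := fun p => by simp [pack]
      right_inv := fun s => by
        change pack _ (ψ ((π ^ δ (e s.2.2.2)) ((π ^ δ (e s.2.2.2)).symm _))) = s
        rw [Equiv.apply_symm_apply, Equiv.apply_symm_apply]
        simp [pack] }
  have hE : ∀ p, E (Prod.map f π p) = cycStep T (E p) := by
    rintro ⟨x, y⟩
    change pack (f x) (ψ ((π ^ δ (f x)) (π y))) = cycStep T (pack x (ψ ((π ^ δ x) y)))
    by_cases hx : x = r
    · have h1 : e.symm x = T.root := by rw [Equiv.symm_apply_eq, hx]; exact hroot.symm
      have h2 : f x = x := by rw [hx, hfr]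
      rw [h2, hx, hr, pow_zero, Equiv.Perm.one_apply, Equiv.Perm.one_apply, hψ, ← hx]
      simp only [pack, cycStep, h1, parent_root]
    · have h1 : T.parent (e.symm x) = some (e.symm (f x)) := by
        cases h : T.parent (e.symm x) with
        | none =>
          have h2 := eq_root_of_parent_eq_none h
          rw [Equiv.symm_apply_eq] at h2
          exact absurd (h2.trans hroot) hx
        | some w =>
          have h2 := hpar _ _ h
          change f (e (e.symm x)) = e w at h2
          rw [Equiv.apply_symm_apply] at h2
          rw [h2, Equiv.symm_apply_apply]
      rw [show (π ^ δ (f x)) (π y) = (π ^ δ x) y by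
        rw [hδ x hx, pow_succ, Equiv.Perm.mul_apply]]
      simp only [pack, cycStep, h1]
  refine ⟨⟨E, ?_⟩⟩
  intro p p'
  rw [adj_iff_cycStep, ← hE, E.apply_eq_iff_eq, eq_comm]
  rfl

end Product

/-! ### Cycles of multiplication by a unit -/

/-- Multiplication by `g` on a finite commutative group is a permutation all of whose cycles have
length `orderOf g`. -/
theorem exists_equiv_fin_prod_fin {G : Type*} [CommGroup G] [Finite G] (g : G) :
    ∃ e : G ≃ Fin (Nat.card G / orderOf g) × Fin (orderOf g),
      ∀ x, e (g * x) = ((e x).1, ⟨((e x).2 + 1) % orderOf g, Nat.mod_lt _ (e x).2.pos⟩) := by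
  have hg : IsOfFinOrder g := isOfFinOrder_of_finite g
  set H := Subgroup.zpowers g
  have hcard : Nat.card (G ⧸ H) = Nat.card G / orderOf g := by
    rw [H.card_eq_card_quotient_mul_card_subgroup, Nat.card_zpowers,
      Nat.mul_div_cancel _ hg.orderOf_pos]
  let e₁ : (G ⧸ H) ≃ Fin (Nat.card G / orderOf g) := Finite.equivFinOfCardEq hcard
  -- Each coset of `⟨g⟩` is one cycle, parametrized by the powers of `g` applied to a
  -- representative.
  let F : Fin (Nat.card G / orderOf g) × Fin (orderOf g) → G :=
    fun p => g ^ (p.2 : ℕ) * (e₁.symm p.1).out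
  have hmk : ∀ p, (F p : G ⧸ H) = e₁.symm p.1 := by
    intro p
    conv_rhs => rw [← Quotient.out_eq' (e₁.symm p.1)]
    refine QuotientGroup.eq.2 ?_
    refine ⟨-(p.2 : ℤ), ?_⟩
    simp only [F, zpow_neg, zpow_natCast, mul_inv]
    rw [inv_mul_cancel_right]
  have hinj : Function.Injective F := by
    rintro ⟨i, c⟩ ⟨j, c'⟩ h
    have h1 := congrArg (fun x : G => (x : G ⧸ H)) h
    simp only [hmk, EmbeddingLike.apply_eq_iff_eq] at h1
    subst h1
    have h2 : g ^ (c : ℕ) = g ^ (c' : ℕ) := mul_right_cancel h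
    rw [pow_inj_mod, Nat.mod_eq_of_lt c.2, Nat.mod_eq_of_lt c'.2] at h2
    rw [Fin.ext h2]
  have hsurj : Function.Surjective F := by
    intro x
    have h1 : ((x : G ⧸ H).out : G ⧸ H) = x := Quotient.out_eq' _
    rw [QuotientGroup.eq] at h1
    obtain ⟨k, hk⟩ := hg.mem_powers_iff_mem_zpowers.2 h1
    refine ⟨(e₁ x, ⟨k % orderOf g, Nat.mod_lt _ hg.orderOf_pos⟩), ?_⟩
    simp only [F, Equiv.symm_apply_apply, pow_mod_orderOf]
    simp only at hk
    rw [hk, mul_comm, mul_inv_cancel_left]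
  let e := (Equiv.ofBijective F ⟨hinj, hsurj⟩).symm
  refine ⟨e, fun x => ?_⟩
  rw [Equiv.symm_apply_eq]
  obtain ⟨p, rfl⟩ := e.symm.surjective x
  rw [Equiv.apply_symm_apply]
  change g * (g ^ (p.2 : ℕ) * _) = g ^ ((p.2 + 1) % orderOf g) * _
  rw [pow_mod_orderOf, pow_succ', mul_assoc]

/-! ### Orders modulo ideals and annihilators in residue rings -/

section Annihilator

variable {D : Type*} [CommRing D]

/-- The order of `a` modulo `m` is the order of the unit that `a` represents. -/
theorem ordMod_eq_orderOf (a : D) (m : Ideal D) [Finite (D ⧸ m)] (u : (D ⧸ m)ˣ)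
    (hu : (u : D ⧸ m) = Ideal.Quotient.mk m a) : ordMod a m = orderOf u := by
  have hiff : ∀ i : ℕ, a ^ i - 1 ∈ m ↔ u ^ i = 1 := by
    intro i
    rw [← Ideal.Quotient.eq, map_pow, map_one, ← hu, ← Units.val_pow_eq_pow_val,
      Units.val_eq_one]
  have hpos : 0 < orderOf u := (isOfFinOrder_of_finite u).orderOf_pos
  refine le_antisymm (Nat.sInf_le ⟨hpos, (hiff _).2 (pow_orderOf_eq_one u)⟩) ?_
  have hmem : ordMod a m ∈ {i : ℕ | 0 < i ∧ a ^ i - 1 ∈ m} :=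
    Nat.sInf_mem ⟨_, hpos, (hiff _).2 (pow_orderOf_eq_one u)⟩
  exact orderOf_le_of_pow_eq_one hmem.1 ((hiff _).1 hmem.2)

theorem isUnit_mk_of_sup_eq_top {a : D} {m : Ideal D} (h : m ⊔ Ideal.span {a} = ⊤) :
    IsUnit (Ideal.Quotient.mk m a) := by
  have h1 : (1 : D) ∈ m ⊔ Ideal.span {a} := h ▸ Submodule.mem_top
  obtain ⟨x, hx, y, hy, hxy⟩ := Submodule.mem_sup.1 h1
  obtain ⟨b, rfl⟩ := Ideal.mem_span_singleton'.1 hy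
  refine IsUnit.of_mul_eq_one (Ideal.Quotient.mk m b) ?_
  rw [← map_mul, ← map_one (Ideal.Quotient.mk m), Ideal.Quotient.eq, ← hxy]
  convert m.neg_mem hx using 1
  ring

variable [IsDedekindDomain D]

/-- As `c` generates `J` modulo `I * J`, the condition `r * c ∈ I * J` says `r J ⊆ I J`, and the
nonzero ideal `J` cancels in a Dedekind domain. -/
theorem mul_mem_mul_iff_of_span_sup_eq {I J : Ideal D} (hJ : J ≠ ⊥) {c : D}
    (hc : J = I * J ⊔ Ideal.span {c}) (r : D) : r * c ∈ I * J ↔ r ∈ I := by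
  constructor
  · intro h
    have h1 : J * Ideal.span {r} ≤ J * I := by
      conv_lhs => rw [hc]
      rw [Ideal.sup_mul, sup_le_iff, mul_comm J I, Ideal.span_singleton_mul_span_singleton,
        Ideal.span_singleton_le_iff_mem, mul_comm c]
      exact ⟨Ideal.mul_le_left.trans le_rfl, h⟩
    have h2 : I ∣ Ideal.span {r} :=
      (mul_dvd_mul_iff_left (by simpa using hJ)).1 (Ideal.dvd_iff_le.2 h1)
    exact (Ideal.span_singleton_le_iff_mem I).1 (Ideal.dvd_iff_le.1 h2)
  · intro h
    refine Ideal.mul_mem_mul h ?_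
    rw [hc]
    exact Ideal.mem_sup_right (Ideal.mem_span_singleton_self c)

/-- For a divisor `m` of `n`, the elements of `D ⧸ n` killed by `m` are the multiples of one
element with annihilator `m`. -/
theorem exists_generator_of_dvd {m n : Ideal D} (hn : n ≠ ⊥) (hm : m ∣ n) :
    ∃ c : D, (∀ r, r * c ∈ n ↔ r ∈ m) ∧
      ∀ y, (∀ r ∈ m, r * y ∈ n) → ∃ x, y - x * c ∈ n := by
  obtain ⟨J, rfl⟩ := hm
  have hm0 : m ≠ ⊥ := by rintro rfl; simp at hn
  have hJ0 : J ≠ ⊥ := by rintro rfl; simp at hn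
  -- The elements killed by `m` form `J / n`, which is cyclic.
  obtain ⟨c, hc⟩ := IsDedekindDomain.exists_sup_span_eq (I := m * J) (J := J) Ideal.mul_le_right hn
  refine ⟨c, mul_mem_mul_iff_of_span_sup_eq hJ0 hc.symm, fun y hy => ?_⟩
  have h1 : m * Ideal.span {y} ≤ m * J := by
    rw [Ideal.mul_le]
    intro r hr s hs
    obtain ⟨t, rfl⟩ := Ideal.mem_span_singleton'.1 hs
    rw [mul_left_comm]
    exact Ideal.mul_mem_left _ t (hy r hr)
  have h2 : J ∣ Ideal.span {y} :=
    (mul_dvd_mul_iff_left (by simpa using hm0)).1 (Ideal.dvd_iff_le.2 h1)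
  have h3 : y ∈ m * J ⊔ Ideal.span {c} :=
    hc.symm ▸ (Ideal.span_singleton_le_iff_mem J).1 (Ideal.dvd_iff_le.1 h2)
  obtain ⟨s, hs, t, ht, rfl⟩ := Submodule.mem_sup.1 h3
  obtain ⟨x, rfl⟩ := Ideal.mem_span_singleton'.1 ht
  exact ⟨x, by simpa using hs⟩

/-- The elements of `D ⧸ n` sorted by their annihilators. -/
theorem exists_equiv_sigma_units [Ring.HasFiniteQuotients D] {n : Ideal D} (hn : n ≠ ⊥) :
    ∃ e : (Σ m : {m : Ideal D // m ∣ n}, (D ⧸ m.1)ˣ) ≃ D ⧸ n,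
      ∀ (b : D) (m : {m : Ideal D // m ∣ n}) (u v : (D ⧸ m.1)ˣ),
        (v : D ⧸ m.1) = Ideal.Quotient.mk m.1 b * u → e ⟨m, v⟩ =
          Ideal.Quotient.mk n b * e ⟨m, u⟩ := by
  choose c hc hgen using fun m : {m : Ideal D // m ∣ n} => exists_generator_of_dvd hn m.2
  choose s hs using fun m : Ideal D => Ideal.Quotient.mk_surjective (I := m)
  let F : (Σ m : {m : Ideal D // m ∣ n}, (D ⧸ m.1)ˣ) → D ⧸ n :=
    fun p => Ideal.Quotient.mk n (s p.1.1 p.2 * c p.1)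
  have hF : ∀ m (u : (D ⧸ m.1)ˣ) (x : D), (u : D ⧸ m.1) = Ideal.Quotient.mk m.1 x →
      F ⟨m, u⟩ = Ideal.Quotient.mk n (x * c m) := by
    intro m u x hx
    rw [Ideal.Quotient.eq, ← sub_mul, hc, ← Ideal.Quotient.eq, hs, hx]
  have hann : ∀ p r, Ideal.Quotient.mk n r * F p = 0 ↔ r ∈ p.1.1 := by
    rintro ⟨m, u⟩ r
    rw [← map_mul, Ideal.Quotient.eq_zero_iff_mem, ← mul_assoc, hc,
      ← Ideal.Quotient.eq_zero_iff_mem, map_mul, hs, Units.mul_left_eq_zero,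
      Ideal.Quotient.eq_zero_iff_mem]
  have hinj : Function.Injective F := by
    rintro ⟨m, u⟩ ⟨m', u'⟩ h
    obtain rfl : m = m' := Subtype.ext (Ideal.ext fun r => by rw [← hann ⟨m, u⟩, h, hann])
    rw [Ideal.Quotient.eq, ← sub_mul, hc, ← Ideal.Quotient.eq, hs, hs, Units.val_inj] at h
    exact congrArg _ h
  have hsurj : Function.Surjective F := by
    intro y
    obtain ⟨y, rfl⟩ := Ideal.Quotient.mk_surjective y
    obtain ⟨m, hmem⟩ : ∃ m : Ideal D, ∀ r, r ∈ m ↔ r * y ∈ n :=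
      ⟨n.colon {y}, fun r => by simp [Submodule.mem_colon]⟩
    have hmn : m ∣ n := Ideal.dvd_iff_le.2 fun r hr => (hmem r).2 (n.mul_mem_right _ hr)
    have hm0 : m ≠ ⊥ := by
      intro h
      rw [h] at hmn
      exact hn (zero_dvd_iff.1 hmn)
    have := Ring.HasFiniteQuotients.finiteQuotient hm0
    obtain ⟨x, hx⟩ := hgen ⟨m, hmn⟩ y fun r hr => (hmem r).1 hr
    -- If `z x ∈ m`, then `z x c`, hence `z y`, lies in `n`, so `z ∈ m`. Thus `x` is not a zero
    -- divisor modulo `m`, and in a finite ring it is a unit.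
    have hunit : IsUnit (Ideal.Quotient.mk m x) := by
      rw [isUnit_iff_mem_nonZeroDivisors_of_finite, mem_nonZeroDivisors_iff_right]
      intro z hz
      obtain ⟨z, rfl⟩ := Ideal.Quotient.mk_surjective z
      rw [← map_mul, Ideal.Quotient.eq_zero_iff_mem, ← hc ⟨m, hmn⟩] at hz
      rw [Ideal.Quotient.eq_zero_iff_mem, hmem]
      convert n.add_mem hz (n.mul_mem_left z hx) using 1
      ring
    refine ⟨⟨⟨m, hmn⟩, hunit.unit⟩, ?_⟩
    rw [hF ⟨m, hmn⟩ hunit.unit x hunit.unit_spec]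
    exact (Ideal.Quotient.eq.2 hx).symm
  refine ⟨Equiv.ofBijective F ⟨hinj, hsurj⟩, fun b m u v huv => ?_⟩
  change F ⟨m, v⟩ = Ideal.Quotient.mk n b * F ⟨m, u⟩
  rw [hF m v (b * s m.1 u) (by rw [huv, map_mul, hs]), mul_assoc, map_mul]

end Annihilator

/-! ### The `ν`-series -/

section NuSeries

variable {D : Type*} [CommRing D]

theorem iterate_aMap (a : D) (n : Ideal D) (k : ℕ) (x : D ⧸ n) :
    (aMap a n)^[k] x = Ideal.Quotient.mk n (a ^ k) * x := by
  induction k with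
  | zero => simp
  | succ k ih => rw [Function.iterate_succ_apply', ih, aMap, pow_succ', map_mul, mul_assoc]

/-- The image of multiplication by `a ^ k` on `D ⧸ n`. -/
def powRange (a : D) (n : Ideal D) (k : ℕ) : AddSubgroup (D ⧸ n) :=
  (AddMonoidHom.mulLeft (Ideal.Quotient.mk n (a ^ k))).range

theorem coe_powRange (a : D) (n : Ideal D) (k : ℕ) :
    (powRange a n k : Set (D ⧸ n)) = Set.range (aMap a n)^[k] := by
  ext x
  simp [powRange, iterate_aMap]

theorem powRange_antitone (a : D) (n : Ideal D) : Antitone (powRange a n) := by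
  intro i j hij
  rw [← SetLike.coe_subset_coe, coe_powRange, coe_powRange]
  exact range_iterate_antitone _ hij

theorem powRange_map (a : D) (n : Ideal D) (k : ℕ) :
    (powRange a n k).map (AddMonoidHom.mulLeft (Ideal.Quotient.mk n a)) = powRange a n (k + 1) := by
  rw [powRange, powRange, AddMonoidHom.map_range]
  congr 1
  ext x
  simp [pow_succ', mul_assoc]

theorem mk_mem_powRange_iff (a : D) (n : Ideal D) (k : ℕ) (x : D) :
    Ideal.Quotient.mk n x ∈ powRange a n k ↔ x ∈ n ⊔ Ideal.span {a ^ k} := by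
  rw [sup_comm, Ideal.mem_span_singleton_sup]
  constructor
  · rintro ⟨y, hy⟩
    obtain ⟨y, rfl⟩ := Ideal.Quotient.mk_surjective y
    rw [AddMonoidHom.coe_mulLeft, ← map_mul, eq_comm, Ideal.Quotient.eq] at hy
    exact ⟨y, _, hy, by ring⟩
  · rintro ⟨y, b, hb, rfl⟩
    refine ⟨Ideal.Quotient.mk n y, ?_⟩
    rw [AddMonoidHom.coe_mulLeft, ← map_mul, eq_comm, Ideal.Quotient.eq]
    convert hb using 1
    ring

/-- The number of points of `a ^ k (D ⧸ n)` killed by `a`. -/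
noncomputable def kerCard (a : D) (n : Ideal D) (k : ℕ) : ℕ :=
  Nat.card ((AddMonoidHom.mulLeft (Ideal.Quotient.mk n a)).ker ⊓ powRange a n k :
    AddSubgroup (D ⧸ n))

/-- Any preimage `z` of `x` in the image of `a ^ k` makes the fibre a translate by `z` of the kernel
within that image. -/
theorem ncard_fiber_eq_kerCard (a : D) (n : Ideal D) (k : ℕ) (x : D ⧸ n)
    (hx : x ∈ Set.range (aMap a n)^[k + 1]) :
    {y ∈ Set.range (aMap a n)^[k] | aMap a n y = x}.ncard = kerCard a n k := by
  rw [← coe_powRange, ← powRange_map] at hx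
  obtain ⟨z, hz, rfl⟩ := hx
  rw [kerCard, ← SetLike.coe_sort_coe, Nat.card_coe_set_eq, eq_comm,
    ← Set.ncard_image_of_injective _ (add_left_injective z), ← coe_powRange, eq_comm]
  congr 1
  ext y
  simp only [Set.mem_ofPred_eq, SetLike.mem_coe, Set.mem_image, AddSubgroup.mem_inf,
    AddMonoidHom.mem_ker, AddMonoidHom.coe_mulLeft, aMap]
  constructor
  · rintro ⟨hy, hyz⟩
    exact ⟨y - z, ⟨by rw [mul_sub, hyz, sub_self], sub_mem hy hz⟩, sub_add_cancel y z⟩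
  · rintro ⟨w, ⟨hw, hw'⟩, rfl⟩
    exact ⟨add_mem hw' hz, by rw [mul_add, hw, zero_add]⟩

theorem kerCard_antitone (a : D) (n : Ideal D) [Finite (D ⧸ n)] : Antitone (kerCard a n) := by
  intro i j hij
  exact Nat.card_mono (Set.toFinite _) (inf_le_inf_left _ (powRange_antitone a n hij))

theorem length_nuSeries (n₀ : Ideal D) (a : D) : (nuSeries n₀ a).length = nuLength n₀ a := by
  simp [nuSeries]

variable [IsDedekindDomain D]

/-- Write `n₀ = J K` with `J = n₀ + ⟨a^k⟩`. Then `J (K + ⟨a⟩) = n₀ + J a = n₀ + ⟨a^(k+1)⟩`, the term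
`n₀ a` being absorbed. -/
theorem nuProd_eq {n₀ : Ideal D} (hn : n₀ ≠ ⊥) (a : D) (k : ℕ) :
    nuProd n₀ a k = n₀ ⊔ Ideal.span {a ^ k} := by
  induction k with
  | zero => simp [nuProd]
  | succ k ih =>
    have hle : n₀ ≤ nuProd n₀ a k := ih ▸ le_sup_left
    obtain ⟨K, hK⟩ := Ideal.dvd_iff_le.2 hle
    have h0 : nuProd n₀ a k ≠ ⊥ := fun h => hn (by rw [hK, h]; simp)
    have h1 : idealQuotient n₀ (nuProd n₀ a k) = K := by
      have h2 := idealQuotient_mul_left h0 K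
      rwa [← hK] at h2
    rw [nuProd, h1, Ideal.mul_sup, ← hK, ih, Ideal.sup_mul, Ideal.span_singleton_mul_span_singleton,
      ← pow_succ, ← sup_assoc, sup_eq_left.2 (Ideal.mul_le_left : n₀ * Ideal.span {a} ≤ n₀)]

/-- Identifies `𝔞_{k+1}` as the annihilator of the cyclic module `a^k M / a^(k+1) M`, where `M = D ⧸
n₀`: the element `a^k` generates `n₀ + ⟨a^k⟩` modulo `n₀ + ⟨a^(k+1)⟩`. -/
theorem mem_nuIdeal_iff {n₀ : Ideal D} (hn : n₀ ≠ ⊥) (a : D) (k : ℕ) (r : D) :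
    r ∈ nuIdeal n₀ a k ↔ r * a ^ k ∈ n₀ ⊔ Ideal.span {a ^ (k + 1)} := by
  have h1 : nuIdeal n₀ a k * nuProd n₀ a k = n₀ ⊔ Ideal.span {a ^ (k + 1)} := by
    rw [← nuProd_eq hn, nuProd, mul_comm, nuIdeal]
  have h0 : nuProd n₀ a k ≠ ⊥ := by
    intro h
    rw [nuProd_eq hn] at h
    exact hn (eq_bot_iff.2 (h ▸ le_sup_left))
  rw [← h1, mul_mem_mul_iff_of_span_sup_eq h0]
  rw [h1, nuProd_eq hn, sup_assoc, sup_eq_right.2 (Ideal.span_singleton_le_span_singleton.2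
    (pow_dvd_pow a k.le_succ))]

/-- With `M = D ⧸ n₀`, the norm is the index of `a^(k+1) M` in `a^k M`. Multiplication by `a` maps
`a^k M` onto `a^(k+1) M`, so this index equals the size of its kernel there; compare two
factorizations of `|a^k M|`. -/
theorem idealNorm_nuIdeal {n₀ : Ideal D} (hn : n₀ ≠ ⊥) [Finite (D ⧸ n₀)] (a : D) (k : ℕ) :
    idealNorm (nuIdeal n₀ a k) = kerCard a n₀ k := by
  let φ : D →+ D ⧸ n₀ := (Ideal.Quotient.mk n₀).toAddMonoidHom.comp (AddMonoidHom.mulRight (a ^ k))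
  have hφ : φ.range = powRange a n₀ k := by
    ext x
    constructor
    · rintro ⟨y, rfl⟩
      exact ⟨Ideal.Quotient.mk n₀ y, by simp [φ, mul_comm]⟩
    · rintro ⟨y, rfl⟩
      obtain ⟨y, rfl⟩ := Ideal.Quotient.mk_surjective y
      exact ⟨y, by simp [φ, mul_comm]⟩
  have hcomap : (powRange a n₀ (k + 1)).comap φ = (nuIdeal n₀ a k).toAddSubgroup := by
    ext x
    rw [AddSubgroup.mem_comap, Submodule.mem_toAddSubgroup, mem_nuIdeal_iff hn,
      ← mk_mem_powRange_iff]
    rfl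
  have h1 : idealNorm (nuIdeal n₀ a k) = (powRange a n₀ (k + 1)).relIndex (powRange a n₀ k) := by
    rw [← hφ, ← AddSubgroup.index_comap, hcomap]
    rfl
  set g := AddMonoidHom.mulLeft (Ideal.Quotient.mk n₀ a) with hg
  have h2 : g.ker.relIndex (powRange a n₀ k) = Nat.card (powRange a n₀ (k + 1)) := by
    rw [AddSubgroup.relIndex_ker, powRange_map]
  have h3 := AddSubgroup.relIndex_mul_relIndex ⊥ (powRange a n₀ (k + 1)) (powRange a n₀ k) bot_le
    (powRange_antitone a n₀ k.le_succ)
  have h4 := AddSubgroup.relIndex_mul_relIndex ⊥ (g.ker ⊓ powRange a n₀ k) (powRange a n₀ k) bot_le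
    inf_le_right
  rw [AddSubgroup.relIndex_bot_left, AddSubgroup.relIndex_bot_left] at h3 h4
  rw [AddSubgroup.inf_relIndex_right, h2, ← h3, ← h1, mul_comm] at h4
  exact (Nat.eq_of_mul_eq_mul_left Nat.card_pos h4).symm

theorem nuLength_spec {n₀ : Ideal D} (hn : n₀ ≠ ⊥) {a : D} (ha : Ideal.span {a} ≤ n₀.radical) :
    0 < nuLength n₀ a ∧ a ^ nuLength n₀ a ∈ n₀ := by
  have hiff : ∀ d, nuProd n₀ a d = n₀ ↔ a ^ d ∈ n₀ := by
    intro d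
    rw [nuProd_eq hn, sup_eq_left, Ideal.span_singleton_le_iff_mem]
  obtain ⟨k, hk⟩ := (Ideal.span_singleton_le_iff_mem _).1 ha
  have h := Nat.sInf_mem (s := {d : ℕ | 0 < d ∧ nuProd n₀ a d = n₀})
    -- The exponent `k` may be 0 when `n₀` is the unit ideal, whereas the length must be positive.
    ⟨k + 1, k.succ_pos, (hiff _).2 (by rw [pow_succ]; exact n₀.mul_mem_right _ hk)⟩
  exact ⟨h.1, (hiff _).1 h.2⟩

theorem nuSeries_eq {n₀ : Ideal D} (hn : n₀ ≠ ⊥) [Finite (D ⧸ n₀)] (a : D) :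
    nuSeries n₀ a = (List.range (nuLength n₀ a)).map (kerCard a n₀) :=
  List.map_congr_left fun k _ => idealNorm_nuIdeal hn a k

theorem isTreeSequence_nuSeries {n₀ : Ideal D} (hn : n₀ ≠ ⊥) [Finite (D ⧸ n₀)] {a : D}
    (ha : Ideal.span {a} ≤ n₀.radical) : IsTreeSequence (nuSeries n₀ a) := by
  refine ⟨?_, ?_, ?_⟩
  · rw [← List.length_pos_iff, length_nuSeries]
    exact (nuLength_spec hn ha).1
  · rw [nuSeries_eq hn, List.pairwise_map]
    exact List.pairwise_lt_range.imp fun h => kerCard_antitone a n₀ h.le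
  · rw [nuSeries_eq hn]
    intro x hx
    obtain ⟨k, -, rfl⟩ := List.mem_map.1 hx
    exact Nat.card_pos

theorem realizes_elementaryTree_nuSeries {n₀ : Ideal D} (hn : n₀ ≠ ⊥) [Finite (D ⧸ n₀)] {a : D}
    (ha : Ideal.span {a} ≤ n₀.radical) :
    Realizes (aMap a n₀) 0 (elementaryTree (nuSeries n₀ a)) 0 := by
  refine realizes_elementaryTree (by simp [aMap]) (isTreeSequence_nuSeries hn ha).1 ?_ ?_
  · intro x
    rw [iterate_aMap, length_nuSeries,
      Ideal.Quotient.eq_zero_iff_mem.2 (nuLength_spec hn ha).2, zero_mul]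
  · intro k hk x hx
    rw [length_nuSeries] at hk
    rw [ncard_fiber_eq_kerCard a n₀ k x hx, nuSeries_eq hn]
    simp [List.getD, hk]

end NuSeries

/-! ### The graph of multiplication by `a` -/

section Cycles

variable {D : Type*} [CommRing D]

/-- Multiplication by an element `a` prime to `m` on the units modulo `m`. -/
theorem exists_equiv_units_fin_prod_fin {a : D} {m : Ideal D} [Finite (D ⧸ m)]
    (h : m ⊔ Ideal.span {a} = ⊤) : 0 < ordMod a m ∧ ordMod a m ∣ idealPhi m ∧
      ∃ u : (D ⧸ m)ˣ, (u : D ⧸ m) = Ideal.Quotient.mk m a ∧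
        ∃ e : (D ⧸ m)ˣ ≃ Fin (idealPhi m / ordMod a m) × Fin (ordMod a m),
          ∀ x, e (u * x) = ((e x).1, ⟨((e x).2 + 1) % ordMod a m, Nat.mod_lt _ (e x).2.pos⟩) := by
  obtain ⟨u, hu⟩ := isUnit_mk_of_sup_eq_top h
  rw [ordMod_eq_orderOf a m u hu]
  exact ⟨(isOfFinOrder_of_finite u).orderOf_pos, orderOf_dvd_natCard u, u, hu,
    exists_equiv_fin_prod_fin u⟩

theorem sup_span_eq_top_of_dvd {a : D} {m n : Ideal D} (h : n ⊔ Ideal.span {a} = ⊤) (hm : m ∣ n) :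
    m ⊔ Ideal.span {a} = ⊤ :=
  top_le_iff.1 (h ▸ sup_le_sup_right (Ideal.le_of_dvd hm) _)

variable [Ring.HasFiniteQuotients D]

theorem finite_quotient_of_dvd {m n : Ideal D} (hn : n ≠ ⊥) (hm : m ∣ n) : Finite (D ⧸ m) :=
  Ring.HasFiniteQuotients.finiteQuotient fun h => hn (zero_dvd_iff.1 (by rwa [h] at hm))

variable [IsDedekindDomain D]

/-- Multiplication by an element `a` prime to `n` on `D ⧸ n`, as a disjoint union of cycles. -/
theorem exists_perm_equiv_sigma {a : D} {n : Ideal D} (hn : n ≠ ⊥)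
    (h : n ⊔ Ideal.span {a} = ⊤) :
    ∃ π : Equiv.Perm (D ⧸ n), ⇑π = aMap a n ∧
      ∃ ψ : (D ⧸ n) ≃ Σ m : {m : Ideal D // m ∣ n},
          Fin (idealPhi m.1 / ordMod a m.1) × Fin (ordMod a m.1),
        ∀ y, ψ (π y) = ⟨(ψ y).1, (ψ y).2.1,
          ⟨((ψ y).2.2 + 1) % ordMod a (ψ y).1.1, Nat.mod_lt _ (ψ y).2.2.pos⟩⟩ := by
  obtain ⟨e, he⟩ := exists_equiv_sigma_units hn
  choose hpos hdvd u hu em hem using fun m : {m : Ideal D // m ∣ n} =>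
    have := finite_quotient_of_dvd hn m.2
    exists_equiv_units_fin_prod_fin (sup_span_eq_top_of_dvd h m.2)
  refine ⟨Units.mulLeft (isUnit_mk_of_sup_eq_top h).unit, rfl,
    e.symm.trans (Equiv.sigmaCongrRight em), fun y => ?_⟩
  obtain ⟨⟨m, v⟩, rfl⟩ := e.surjective y
  have h1 : (Units.mulLeft (isUnit_mk_of_sup_eq_top h).unit) (e ⟨m, v⟩) = e ⟨m, u m * v⟩ := by
    rw [he a m v (u m * v) (by rw [Units.val_mul, hu])]
    rfl
  have h2 : ∀ p, (e.symm.trans (Equiv.sigmaCongrRight em)) (e p) = ⟨p.1, em p.1 p.2⟩ := fun p => by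
    rw [Equiv.trans_apply, Equiv.symm_apply_apply]
    rfl
  rw [h1, h2, h2, hem]

end Cycles

end AMap

/-! ### Assembly by the Chinese remainder theorem -/

theorem theorem3p1 {D : Type*} [CommRing D] [IsDedekindDomain D] [Ring.HasFiniteQuotients D]
    (a : D) (ha : a ≠ 0) (n n₀ n₁ : Ideal D) (hn : n ≠ ⊥)
    (hdec : AMap.IsADecomposition a n n₀ n₁) :
    AMap.IsTreeSequence (AMap.nuSeries n₀ a) ∧
    (∀ m : Ideal D, m ∣ n₁ → 0 < AMap.ordMod a m ∧ AMap.ordMod a m ∣ AMap.idealPhi m) ∧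
    Nonempty (AMap.DigraphIso
      (AMap.functionalGraph (AMap.aMap a n))
      (AMap.disjointUnion fun m : {m : Ideal D // m ∣ n₁} =>
        AMap.copies (AMap.idealPhi m.1 / AMap.ordMod a m.1)
          (AMap.cyc (AMap.ordMod a m.1) (AMap.elementaryTree (AMap.nuSeries n₀ a))))) := by
  obtain ⟨rfl, hrad, hcop⟩ := hdec
  have hn₀ : n₀ ≠ ⊥ := by rintro rfl; simp at hn
  have hn₁ : n₁ ≠ ⊥ := by rintro rfl; simp at hn
  have := Ring.HasFiniteQuotients.finiteQuotient hn₀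
  refine ⟨AMap.isTreeSequence_nuSeries hn₀ hrad, fun m hm => ?_, ?_⟩
  · have := AMap.finite_quotient_of_dvd hn₁ hm
    have h := AMap.exists_equiv_units_fin_prod_fin (AMap.sup_span_eq_top_of_dvd hcop hm)
    exact ⟨h.1, h.2.1⟩
  have hpow := (AMap.nuLength_spec hn₀ hrad).2
  -- `n₁` is coprime to `a`, hence to the power of `a` that lies in `n₀`.
  have hcop' : IsCoprime n₀ n₁ := by
    rw [isCoprime_comm, Ideal.isCoprime_iff_sup_eq, eq_top_iff]
    have h1 := (Ideal.isCoprime_iff_sup_eq.2 hcop).pow_right (n := AMap.nuLength n₀ a)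
    rw [Ideal.isCoprime_iff_sup_eq, Ideal.span_singleton_pow] at h1
    rw [← h1]
    exact sup_le_sup_left ((Ideal.span_singleton_le_iff_mem _).2 hpow) _
  obtain ⟨π, hπ, ψ, hψ⟩ := AMap.exists_perm_equiv_sigma hn₁ hcop
  obtain ⟨E⟩ := AMap.nonempty_iso_of_realizes (f := AMap.aMap a n₀) (by simp [AMap.aMap])
    (fun x => ⟨AMap.nuLength n₀ a, by
      rw [AMap.iterate_aMap, Ideal.Quotient.eq_zero_iff_mem.2 hpow, zero_mul]⟩)
    (AMap.realizes_elementaryTree_nuSeries hn₀ hrad) π ψ hψ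
  let F := Ideal.quotientMulEquivQuotientProd n₀ n₁ hcop'
  have hF : ∀ x, F (AMap.aMap a (n₀ * n₁) x) =
      Prod.map (AMap.aMap a n₀) π (F x) := by
    intro x
    rw [AMap.aMap, map_mul, hπ]
    rfl
  refine ⟨RelIso.trans ⟨F.toEquiv, ?_⟩ E⟩
  intro x y
  change Prod.map (AMap.aMap a n₀) π (F x) = F y ↔ AMap.aMap a (n₀ * n₁) x = y
  rw [← hF, F.injective.eq_iff]
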